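/- Let $d\ge 1$, let $\nu_1,\dots,\nu_d$ be Borel probability measures on $\mathbb{R}$, let $I$ be an arbitrary index set, and for each $i\in I$ let $A^i=(-\infty,A^i_1]\times\cdots\times(-\infty,A^i_d]\subset\mathbb{R}^d$ with $A^i_1,\dots,A^i_d\in\mathbb{R}$, and let $0\le\underline{\pi}^i\le\overline{\pi}^i\le 1$ be real numbers. A strategy is a tuple $(f_1,\dots,f_d,a)$ of bounded Borel measurable functions $f_j\colon\mathbb{R}\to\mathbb{R}$ and a family $a=(a^i)_{i\in I}$ of real numbers with $a^i=0$ for all but finitely many $i$. Its price is $$\pi(f_1,\dots,f_d,a)=\sum_{j=1}^d\int_{\mathbb{R}}f_j\,\mathrm{d}\nu_j+\sum_{i\in I}\big(\max\{a^i,0\}\,\overline{\pi}^i-\max\{-a^i,0\}\,\underline{\pi}^i\big).$$ For $f\colon\mathbb{R}^d\to\mathbb{R}$ let $\Theta(f)$ be the set of strategies with $\sum_{j=1}^d f_j(x_j)+\sum_{i\in I}a^i1_{A^i}(x)\ge f(x)$ for all $x\in\mathbb{R}^d$, and let $\Theta_0(f)$ be the set of those strategies in $\Theta(f)$ with $f_1,\dots,f_d\ge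 0$ and $a^i\ge 0$ for all $i\in I$. Let $\phi(f)$ and $\phi_0(f)$ be the infima, in $[-\infty,+\infty]$, of $\pi$ over $\Theta(f)$ and $\Theta_0(f)$, respectively. A uniform strong arbitrage is a strategy that lies in $\Theta(\varepsilon)$ for some constant $\varepsilon>0$ and satisfies $\pi(f_1,\dots,f_d,a)\le 0$. Let $\mathcal{Q}$ be the set of Borel probability measures $\mu$ on $\mathbb{R}^d$ whose marginals are $\mu_j=\nu_j$ for $j=1,\dots,d$ and that satisfy $\underline{\pi}^i\le\mu(A^i)\le\overline{\pi}^i$ for all $i\in I$. Let $\mathcal{Q}_0$ be the set of Borel measures $\mu$ on $\mathbb{R}^d$ with $\mu(\mathbb{R}^d)\le 1$, with $\mu_j(B)\le\nu_j(B)$ for all $j=1,\dots,d$ and all Borel sets $B\subset\mathbb{R}$, and with $\mu(A^i)\le\overline{\pi}^i$ for all $i\in I$. **Theorem 2.3.** Let $f\colon\mathbb{R}^d\to\mathbb{R}$ be bounded and upper semicontinuous. Then there is no uniform strong arbitrage if and only if $\mathcal{Q}$ is not empty. In this case $$\phi(f)=\max_{\mu\in\mathcal{Q}}\int_{\mathbb{R}^d}f\,\mathrm{d}\mu.$$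 Moreover, whether or not $\mathcal{Q}$ is empty, $$\phi_0(f)=\max_{\mu\in\mathcal{Q}_0}\int_{\mathbb{R}^d}f\,\mathrm{d}\mu.$$ Both maxima are attained. -/

import Mathlib

open MeasureTheory

namespace MarginalTransport

/-- The closed lower-left orthant `(-∞, c₁] × ⋯ × (-∞, c_d]` with corner `c`. -/
def orthant {d : ℕ} (c : Fin d → ℝ) : Set (Fin d → ℝ) :=
  Set.univ.pi fun j => Set.Iic (c j)

/-- A trading strategy `(f₁, …, f_d, a)`: bounded Borel functions `f_j : ℝ → ℝ` and a family
`a ∈ ℝ^I` all but finitely many entries of which vanish. -/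
structure Strategy (d : ℕ) (I : Type*) where
  f : Fin d → ℝ → ℝ
  measurable_f : ∀ j, Measurable (f j)
  bounded_f : ∀ j, ∃ C : ℝ, ∀ t, |f j t| ≤ C
  a : I →₀ ℝ

variable {d : ℕ} {I : Type*}

/-- The payoff `f₁(x₁) + ⋯ + f_d(x_d) + ∑ aⁱ 1_{Aⁱ}(x)`, where `Aⁱ` is the orthant with
corner `c i`. -/
noncomputable def Strategy.payoff (c : I → Fin d → ℝ) (h : Strategy d I) (x : Fin d → ℝ) : ℝ :=
  (∑ j, h.f j (x j)) +
    h.a.sum fun i r => r * (orthant (c i)).indicator (fun _ => (1 : ℝ)) x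

/-- The price `∫ f₁ dν₁ + ⋯ + ∫ f_d dν_d + ∑ (aⁱ⁺ πuⁱ - aⁱ⁻ πlⁱ)`. -/
noncomputable def Strategy.price (ν : Fin d → Measure ℝ) (πl πu : I → ℝ) (h : Strategy d I) : ℝ :=
  (∑ j, ∫ t, h.f j t ∂(ν j)) +
    h.a.sum fun i r => max r 0 * πu i - max (-r) 0 * πl i

/-- The strategies that superhedge `f` at every point. -/
def superhedges (c : I → Fin d → ℝ) (f : (Fin d → ℝ) → ℝ) : Set (Strategy d I) :=
  {h | ∀ x, f x ≤ h.payoff c x}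

/-- The superhedging strategies with nonnegative positions only. -/
def superhedgesNonneg (c : I → Fin d → ℝ) (f : (Fin d → ℝ) → ℝ) : Set (Strategy d I) :=
  {h | h ∈ superhedges c f ∧ (∀ j t, 0 ≤ h.f j t) ∧ ∀ i, 0 ≤ h.a i}

/-- The superhedging value `φ(f)`, an infimum in the extended reals. -/
noncomputable def superhedgingValue (ν : Fin d → Measure ℝ) (c : I → Fin d → ℝ) (πl πu : I → ℝ)
    (f : (Fin d → ℝ) → ℝ) : EReal :=
  ⨅ h ∈ superhedges c f, ((h.price ν πl πu : ℝ) : EReal)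

/-- The relaxed superhedging value `φ₀(f)`, an infimum in the extended reals. -/
noncomputable def superhedgingValueNonneg (ν : Fin d → Measure ℝ) (c : I → Fin d → ℝ)
    (πl πu : I → ℝ) (f : (Fin d → ℝ) → ℝ) : EReal :=
  ⨅ h ∈ superhedgesNonneg c f, ((h.price ν πl πu : ℝ) : EReal)

/-- `h` is a uniform strong arbitrage: its price is at most zero and, for some `ε > 0`, its payoff
is everywhere at least `ε`. -/
def IsUniformStrongArbitrage (ν : Fin d → Measure ℝ) (c : I → Fin d → ℝ) (πl πu : I → ℝ)
    (h : Strategy d I) : Prop :=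
  ∃ ε : ℝ, 0 < ε ∧ h ∈ superhedges c (fun _ => ε) ∧ h.price ν πl πu ≤ 0

/-- `𝒬`: the probability measures with marginals `ν_j` and `πlⁱ ≤ μ(Aⁱ) ≤ πuⁱ` for all `i`. -/
def couplings (ν : Fin d → Measure ℝ) (c : I → Fin d → ℝ) (πl πu : I → ℝ) :
    Set (Measure (Fin d → ℝ)) :=
  {μ | IsProbabilityMeasure μ ∧ (∀ j, μ.map (fun x => x j) = ν j) ∧
    ∀ i, πl i ≤ μ.real (orthant (c i)) ∧ μ.real (orthant (c i)) ≤ πu i}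

/-- `𝒬₀`: the measures of total mass at most one whose marginals are setwise dominated by the
`ν_j` and with `μ(Aⁱ) ≤ πuⁱ` for all `i`. -/
def subcouplings (ν : Fin d → Measure ℝ) (c : I → Fin d → ℝ) (πu : I → ℝ) :
    Set (Measure (Fin d → ℝ)) :=
  {μ | μ Set.univ ≤ 1 ∧
    (∀ j, ∀ B : Set ℝ, MeasurableSet B → μ.map (fun x => x j) B ≤ ν j B) ∧
    ∀ i, μ.real (orthant (c i)) ≤ πu i}

end MarginalTransport

open Filter Topology
open scoped CompactlySupported

namespace MarginalTransport

/-! ### Cutoffs and vanishing tails -/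

section PositiveFunctional

variable {d : ℕ}

/-! Weak duality is integration of the hedging inequality (`Strategy.integral_le_price`). For strong
duality, the superhedging price over a cone of admissible strategies is a sublinear functional on
bounded functions, finite because the cone admits no arbitrarily cheap hedges. Hahn-Banach gives a
linear `L` below it with equality at `f` (`IsPricingCone.exists_linearMap`). Such an `L` is
positive, but need not be given by a measure.

The marginals repair this. `L` applied to a nonnegative function of one coordinate is at most its `ν
j`-integral, so no mass escapes to infinity and the Riesz measure `μ` of `L` on `C_c` represents `L`
on all bounded continuous functions (`IsDominated.integral_of_continuous`). Approximation from above
gives `L f ≤ ∫ f dμ` for upper semicontinuous `f` (`IsDominated.le_integral`), so the value is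
attained at `μ`. On orthants `L` and `μ` agree exactly (`IsDominated.measureReal_orthant`), so bid
and ask bounds both pass to `μ`.

Both dualities are instances of `IsPricingCone.exists_measure`: the cone of all strategies, where
absence of arbitrage gives finiteness, and the cone of nonnegative ones, where prices are
nonnegative anyway. The constraints on `μ` reflect which constants and options the cone contains. -/

/-- A continuous function with values in `[0, 1]` that is one on the ball of radius `n` and
vanishes outside the ball of radius `n + 1`. -/
noncomputable def cutoff (d n : ℕ) (x : Fin d → ℝ) : ℝ := max 0 (min 1 (n + 1 - ‖x‖))

lemma continuous_cutoff (d n : ℕ) : Continuous (cutoff d n) := by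
  unfold cutoff; fun_prop

lemma cutoff_nonneg (n : ℕ) (x : Fin d → ℝ) : 0 ≤ cutoff d n x := le_max_left _ _

lemma cutoff_le_one (n : ℕ) (x : Fin d → ℝ) : cutoff d n x ≤ 1 :=
  max_le zero_le_one (min_le_left _ _)

lemma cutoff_eq_one {n : ℕ} {x : Fin d → ℝ} (hx : ‖x‖ ≤ n) : cutoff d n x = 1 := by
  rw [cutoff, min_eq_left (by linarith), max_eq_right zero_le_one]

lemma hasCompactSupport_cutoff (d n : ℕ) : HasCompactSupport (cutoff d n) := by
  refine HasCompactSupport.of_support_subset_isCompact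
    (isCompact_closedBall (0 : Fin d → ℝ) (n + 1)) fun x hx => ?_
  rw [mem_closedBall_zero_iff]
  by_contra! h
  exact hx (max_eq_left ((min_le_right _ _).trans (by linarith)))

/-- A point of sup norm above `n` has a coordinate above `n` in absolute value, so escape to
infinity is controlled by one-dimensional tails. -/
lemma one_sub_cutoff_le (n : ℕ) (x : Fin d → ℝ) :
    1 - cutoff d n x ≤ ∑ j, {t : ℝ | (n : ℝ) < |t|}.indicator (fun _ => (1 : ℝ)) (x j) := by
  have h0 : ∀ j ∈ Finset.univ,
      0 ≤ {t : ℝ | (n : ℝ) < |t|}.indicator (fun _ => (1 : ℝ)) (x j) :=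
    fun j _ => Set.indicator_nonneg (fun _ _ => zero_le_one) _
  by_cases h : ‖x‖ ≤ n
  · rw [cutoff_eq_one h, sub_self]
    exact Finset.sum_nonneg h0
  · have : ∃ j, (n : ℝ) < |x j| := by
      by_contra! hc
      exact h ((pi_norm_le_iff_of_nonneg n.cast_nonneg).2 hc)
    obtain ⟨j, hj⟩ := this
    refine le_trans ?_ (Finset.single_le_sum h0 (Finset.mem_univ j))
    rw [Set.indicator_of_mem (show x j ∈ {t : ℝ | (n : ℝ) < |t|} from hj)]
    linarith [cutoff_nonneg n x]

lemma tendsto_measureReal_abs_gt (ν : Measure ℝ) [IsFiniteMeasure ν] :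
    Tendsto (fun n : ℕ => ν.real {t : ℝ | (n : ℝ) < |t|}) atTop (𝓝 0) := by
  have h : Tendsto (fun n : ℕ => ν {t : ℝ | (n : ℝ) < |t|}) atTop
      (𝓝 (ν (⋂ n : ℕ, {t : ℝ | (n : ℝ) < |t|}))) := by
    refine tendsto_measure_iInter_atTop
      (fun n => (measurableSet_lt measurable_const measurable_id.abs).nullMeasurableSet)
      (fun m n hmn t (ht : (n : ℝ) < |t|) => lt_of_le_of_lt (Nat.cast_le.2 hmn) ht)
      ⟨0, measure_ne_top _ _⟩
  have he : (⋂ n : ℕ, {t : ℝ | (n : ℝ) < |t|}) = ∅ := by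
    refine Set.eq_empty_of_forall_notMem fun t ht => ?_
    obtain ⟨n, hn⟩ := exists_nat_gt |t|
    exact lt_asymm hn (Set.mem_iInter.1 ht n)
  rw [he, measure_empty] at h
  exact (ENNReal.tendsto_toReal ENNReal.zero_ne_top).comp h

/-- Excluding `a` makes the intersection empty, so an atom of `ν` at `a` does no harm. -/
lemma tendsto_measureReal_Ioo (ν : Measure ℝ) [IsFiniteMeasure ν] (a : ℝ) :
    Tendsto (fun n : ℕ => ν.real (Set.Ioo a (a + 1 / ((n : ℝ) + 1)))) atTop (𝓝 0) := by
  have h : Tendsto (fun n : ℕ => ν (Set.Ioo a (a + 1 / ((n : ℝ) + 1)))) atTop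
      (𝓝 (ν (⋂ n : ℕ, Set.Ioo a (a + 1 / ((n : ℝ) + 1))))) := by
    refine tendsto_measure_iInter_atTop (fun n => measurableSet_Ioo.nullMeasurableSet)
      (fun m n hmn => Set.Ioo_subset_Ioo_right ?_) ⟨0, measure_ne_top _ _⟩
    have := Nat.one_div_le_one_div (α := ℝ) hmn
    linarith
  have he : (⋂ n : ℕ, Set.Ioo a (a + 1 / ((n : ℝ) + 1))) = ∅ := by
    refine Set.eq_empty_of_forall_notMem fun t ht => ?_
    have h0 := (Set.mem_iInter.1 ht 0).1
    obtain ⟨n, hn⟩ := exists_nat_one_div_lt (sub_pos.2 h0)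
    have := (Set.mem_iInter.1 ht n).2
    linarith
  rw [he, measure_empty] at h
  exact (ENNReal.tendsto_toReal ENNReal.zero_ne_top).comp h

/-! ### Dominated functionals and their representing measures -/

/-- `L` is nonnegative on bounded nonnegative functions, and on bounded nonnegative Borel functions
of the `j`-th coordinate it is dominated by the integral with respect to `ν j`. -/
structure IsDominated (ν : Fin d → Measure ℝ) (L : ((Fin d → ℝ) → ℝ) →ₗ[ℝ] ℝ) : Prop where
  nonneg : ∀ g : (Fin d → ℝ) → ℝ, (∃ C, ∀ x, |g x| ≤ C) → (∀ x, 0 ≤ g x) → 0 ≤ L g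
  marginal_le : ∀ (j : Fin d) (g : ℝ → ℝ), Measurable g → (∃ C, ∀ t, |g t| ≤ C) →
    (∀ t, 0 ≤ g t) → L (fun x => g (x j)) ≤ ∫ t, g t ∂(ν j)

variable {ν : Fin d → Measure ℝ} {L : ((Fin d → ℝ) → ℝ) →ₗ[ℝ] ℝ}

lemma IsDominated.mono (hL : IsDominated ν L) {g₁ g₂ : (Fin d → ℝ) → ℝ}
    (h₁ : ∃ C, ∀ x, |g₁ x| ≤ C) (h₂ : ∃ C, ∀ x, |g₂ x| ≤ C) (h : ∀ x, g₁ x ≤ g₂ x) :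
    L g₁ ≤ L g₂ := by
  obtain ⟨C₁, h₁⟩ := h₁
  obtain ⟨C₂, h₂⟩ := h₂
  have := hL.nonneg (g₂ - g₁) ⟨C₂ + C₁, fun x => (abs_sub _ _).trans (add_le_add (h₂ x) (h₁ x))⟩
    fun x => sub_nonneg.2 (h x)
  rw [map_sub] at this
  linarith

lemma exists_bound_sum_indicator (B : Fin d → Set ℝ) :
    ∃ C, ∀ x : Fin d → ℝ, |∑ j, (B j).indicator (fun _ => (1 : ℝ)) (x j)| ≤ C := by
  refine ⟨∑ _j : Fin d, 1, fun x => (Finset.abs_sum_le_sum_abs _ _).trans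
    (Finset.sum_le_sum fun j _ => ?_)⟩
  by_cases h : x j ∈ B j <;> simp [h]

lemma IsDominated.sum_indicator_le (hL : IsDominated ν L) {B : Fin d → Set ℝ}
    (hB : ∀ j, MeasurableSet (B j)) :
    L (fun x => ∑ j, (B j).indicator (fun _ => (1 : ℝ)) (x j)) ≤ ∑ j, (ν j).real (B j) := by
  have : (fun x : Fin d → ℝ => ∑ j, (B j).indicator (fun _ => (1 : ℝ)) (x j)) =
      ∑ j, fun x : Fin d → ℝ => (B j).indicator (fun _ => (1 : ℝ)) (x j) := by
    ext x; simp
  rw [this, map_sum]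
  refine Finset.sum_le_sum fun j _ => ?_
  refine (hL.marginal_le j _ (measurable_const.indicator (hB j)) ⟨1, fun t => ?_⟩
    (Set.indicator_nonneg fun _ _ => zero_le_one)).trans_eq (integral_indicator_one (hB j))
  by_cases h : t ∈ B j <;> simp [h]

/-- The restriction of a dominated functional to continuous functions of compact support. -/
noncomputable def IsDominated.toPositiveLinearMap (hL : IsDominated ν L) :
    C_c(Fin d → ℝ, ℝ) →ₚ[ℝ] ℝ :=
  PositiveLinearMap.mk₀
    { toFun := fun g => L g
      map_add' := fun g₁ g₂ => map_add L (g₁ : (Fin d → ℝ) → ℝ) g₂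
      map_smul' := fun r g => map_smul L r (g : (Fin d → ℝ) → ℝ) }
    fun g hg => hL.nonneg g (by
      obtain ⟨C, hC⟩ := g.hasCompactSupport.exists_bound_of_continuous g.continuous
      exact ⟨C, hC⟩) hg

/-- The measure representing a dominated functional on bounded continuous functions. -/
noncomputable def IsDominated.measure (hL : IsDominated ν L) : Measure (Fin d → ℝ) :=
  RealRMK.rieszMeasure hL.toPositiveLinearMap

lemma IsDominated.integral_of_hasCompactSupport (hL : IsDominated ν L) {g : (Fin d → ℝ) → ℝ}
    (hg : Continuous g) (hgc : HasCompactSupport g) : ∫ x, g x ∂hL.measure = L g :=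
  RealRMK.integral_rieszMeasure hL.toPositiveLinearMap ⟨⟨g, hg⟩, hgc⟩

/-- Each compact set lies under a cutoff, so its mass is at most `L 1`; inner regularity passes this
bound to the whole space. -/
instance IsDominated.isFiniteMeasure (hL : IsDominated ν L) : IsFiniteMeasure hL.measure := by
  have : hL.measure.Regular := RealRMK.regular_rieszMeasure _
  refine ⟨lt_of_le_of_lt ?_ (ENNReal.ofReal_lt_top (r := L fun _ => 1))⟩
  rw [isOpen_univ.measure_eq_iSup_isCompact]
  refine iSup₂_le fun K _ => iSup_le fun hK => ?_
  obtain ⟨r, hr⟩ := hK.isBounded.exists_norm_le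
  obtain ⟨n, hn⟩ := exists_nat_ge r
  refine (RealRMK.rieszMeasure_le_of_eq_one hL.toPositiveLinearMap
    (f := ⟨⟨cutoff d n, continuous_cutoff d n⟩, hasCompactSupport_cutoff d n⟩)
    (cutoff_nonneg n) hK fun x hx => cutoff_eq_one ((hr x hx).trans hn)).trans ?_
  refine ENNReal.ofReal_le_ofReal (hL.mono ⟨1, fun x => ?_⟩ ⟨1, by simp⟩ (cutoff_le_one n))
  exact (abs_of_nonneg (cutoff_nonneg n x)).trans_le (cutoff_le_one n x)

lemma integrable_of_bound {X : Type*} [MeasurableSpace X] {μ : Measure X} [IsFiniteMeasure μ]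
    {g : X → ℝ} (hg : Measurable g) (hb : ∃ C, ∀ x, |g x| ≤ C) : Integrable g μ := by
  obtain ⟨C, hC⟩ := hb
  exact Integrable.of_bound hg.aestronglyMeasurable C (ae_of_all _ hC)

/-- This is tightness: truncating `g` by a cutoff changes `L g` by at most `C` times the sum of the
marginal tails, which tends to zero, while the integrals converge by dominated convergence. -/
theorem IsDominated.integral_of_continuous [∀ j, IsFiniteMeasure (ν j)] (hL : IsDominated ν L)
    {g : (Fin d → ℝ) → ℝ} (hg : Continuous g) (hb : ∃ C, ∀ x, |g x| ≤ C) :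
    ∫ x, g x ∂hL.measure = L g := by
  obtain ⟨C, hC⟩ := hb
  have hC0 : 0 ≤ C := (abs_nonneg _).trans (hC 0)
  have habs : ∀ n x, |g x * cutoff d n x| ≤ C := fun n x => by
    rw [abs_mul, abs_of_nonneg (cutoff_nonneg n x)]
    exact (mul_le_of_le_one_right (abs_nonneg _) (cutoff_le_one n x)).trans (hC x)
  have hint : Tendsto (fun n => ∫ x, g x * cutoff d n x ∂hL.measure) atTop
      (𝓝 (∫ x, g x ∂hL.measure)) := by
    refine tendsto_integral_of_dominated_convergence (fun _ => C)
      (fun n => (hg.mul (continuous_cutoff d n)).aestronglyMeasurable) (integrable_const C)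
      (fun n => ae_of_all _ (habs n)) (ae_of_all _ fun x => ?_)
    obtain ⟨N, hN⟩ := exists_nat_ge ‖x‖
    refine tendsto_const_nhds.congr' ?_
    filter_upwards [eventually_ge_atTop N] with n hn
    rw [cutoff_eq_one (hN.trans (Nat.cast_le.2 hn)), mul_one]
  have htail : Tendsto (fun n : ℕ => C * ∑ j, (ν j).real {t : ℝ | (n : ℝ) < |t|}) atTop (𝓝 0) := by
    simpa using (tendsto_finsetSum Finset.univ
      fun j _ => tendsto_measureReal_abs_gt (ν j)).const_mul C
  have hlim : Tendsto (fun n => L fun x => g x * cutoff d n x) atTop (𝓝 (L g)) := by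
    rw [tendsto_iff_norm_sub_tendsto_zero]
    refine squeeze_zero (fun _ => norm_nonneg _) (fun n => ?_) htail
    set B : Fin d → Set ℝ := fun _ => {t : ℝ | (n : ℝ) < |t|}
    have hB : ∀ j, MeasurableSet (B j) := fun j =>
      measurableSet_lt measurable_const measurable_id.abs
    set s : (Fin d → ℝ) → ℝ := fun x => ∑ j, (B j).indicator (fun _ => (1 : ℝ)) (x j)
    have hs := mul_le_mul_of_nonneg_left (hL.sum_indicator_le hB) hC0
    have hsb : ∃ C', ∀ x, |(C • s) x| ≤ C' := by
      obtain ⟨C', h⟩ := exists_bound_sum_indicator B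
      refine ⟨C * C', fun x => ?_⟩
      rw [Pi.smul_apply, smul_eq_mul, abs_mul, abs_of_nonneg hC0]
      exact mul_le_mul_of_nonneg_left (h x) hC0
    have hdiff : ∀ x, |g x * cutoff d n x - g x| ≤ (C • s) x := fun x => by
      rw [show g x * cutoff d n x - g x = -(g x * (1 - cutoff d n x)) by ring, abs_neg, abs_mul,
        abs_of_nonneg (sub_nonneg.2 (cutoff_le_one n x))]
      exact mul_le_mul (hC x) (one_sub_cutoff_le n x) (sub_nonneg.2 (cutoff_le_one n x)) hC0
    have hdb : ∃ C', ∀ x, |((fun x => g x * cutoff d n x) - g) x| ≤ C' :=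
      ⟨C + C, fun x => (abs_sub _ _).trans (add_le_add (habs n x) (hC x))⟩
    have h1 := hL.mono hdb hsb fun x => (abs_le.1 (hdiff x)).2
    have h2 := hL.mono (g₁ := -((fun x => g x * cutoff d n x) - g)) (by simpa only [Pi.neg_apply, abs_neg] using hdb) hsb
      fun x => neg_le.1 (abs_le.1 (hdiff x)).1
    rw [map_neg, map_sub, map_smul, smul_eq_mul] at h2
    rw [map_sub, map_smul, smul_eq_mul] at h1
    rw [Real.norm_eq_abs, abs_le]
    constructor <;> linarith
  refine tendsto_nhds_unique hint (hlim.congr fun n => ?_)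
  exact (hL.integral_of_hasCompactSupport (hg.mul (continuous_cutoff d n))
    ((hasCompactSupport_cutoff d n).mul_left)).symm

/-- Continuous thickened indicators transfer the domination to closed sets, and inner regularity by
closed sets extends it to Borel sets. -/
theorem IsDominated.map_measure_le [∀ j, IsFiniteMeasure (ν j)] (hL : IsDominated ν L)
    (j : Fin d) : hL.measure.map (fun x => x j) ≤ ν j := by
  have hclosed : ∀ F : Set ℝ, IsClosed F → hL.measure.map (fun x => x j) F ≤ ν j F := by
    intro F hF
    have hm : Measurable fun x : Fin d → ℝ => x j := measurable_pi_apply j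
    have hδ : ∀ n : ℕ, (0 : ℝ) < 1 / ((n : ℝ) + 1) := fun n => Nat.one_div_pos_of_nat
    have h1 := tendsto_integral_thickenedIndicator_of_isClosed
      (hL.measure.map fun x => x j) hF hδ tendsto_one_div_add_atTop_nhds_zero_nat
    have h2 := tendsto_integral_thickenedIndicator_of_isClosed
      (ν j) hF hδ tendsto_one_div_add_atTop_nhds_zero_nat
    have h3 := le_of_tendsto_of_tendsto' h1 h2 fun n => by
      have hc : Continuous fun t => ((thickenedIndicator (hδ n) F t : NNReal) : ℝ) :=
        NNReal.continuous_coe.comp (thickenedIndicator (hδ n) F).continuous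
      have hb : ∀ t, |((thickenedIndicator (hδ n) F t : NNReal) : ℝ)| ≤ 1 := fun t => by
        rw [NNReal.abs_eq]; exact_mod_cast thickenedIndicator_le_one (hδ n) F t
      rw [integral_map hm.aemeasurable hc.aestronglyMeasurable,
        hL.integral_of_continuous (g := fun x => ((thickenedIndicator (hδ n) F (x j) : NNReal) : ℝ))
          (hc.comp (continuous_apply j)) ⟨1, fun x => hb _⟩]
      exact hL.marginal_le j _ hc.measurable ⟨1, hb⟩ fun t => NNReal.coe_nonneg _
    exact (ENNReal.toReal_le_toReal (measure_ne_top _ _) (measure_ne_top _ _)).1 h3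
  refine Measure.le_iff.2 fun B hB => ?_
  rw [hB.measure_eq_iSup_isClosed_of_ne_top (measure_ne_top _ _)]
  exact iSup₂_le fun F hFB => iSup_le fun hF => (hclosed F hF).trans (measure_mono hFB)

/-! ### Upper semicontinuous functions and orthants -/

/-- The `n`-Lipschitz sup-convolution of a bounded function. -/
noncomputable def supConv {X : Type*} [PseudoMetricSpace X] (f : X → ℝ) (n : ℕ) (x : X) : ℝ :=
  ⨆ y, f y - n * dist x y

section SupConv

variable {X : Type*} [PseudoMetricSpace X] {f : X → ℝ} {C : ℝ}

lemma bddAbove_supConv (hC : ∀ x, |f x| ≤ C) (n : ℕ) (x : X) :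
    BddAbove (Set.range fun y => f y - n * dist x y) := by
  refine ⟨C, ?_⟩
  rintro _ ⟨y, rfl⟩
  have := (abs_le.1 (hC y)).2
  have : 0 ≤ (n : ℝ) * dist x y := by positivity
  dsimp only
  linarith

lemma le_supConv (hC : ∀ x, |f x| ≤ C) (n : ℕ) (x : X) : f x ≤ supConv f n x := by
  have := le_ciSup (bddAbove_supConv hC n x) x
  rwa [dist_self, mul_zero, sub_zero] at this

lemma abs_supConv_le (hC : ∀ x, |f x| ≤ C) (n : ℕ) (x : X) : |supConv f n x| ≤ C := by
  have : Nonempty X := ⟨x⟩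
  refine abs_le.2 ⟨(abs_le.1 (hC x)).1.trans (le_supConv hC n x), ciSup_le fun y => ?_⟩
  have := (abs_le.1 (hC y)).2
  have : 0 ≤ (n : ℝ) * dist x y := by positivity
  linarith

lemma continuous_supConv (hC : ∀ x, |f x| ≤ C) (n : ℕ) : Continuous (supConv f n) := by
  refine (LipschitzWith.of_le_add_mul (n : NNReal) fun x y => ?_).continuous
  have : Nonempty X := ⟨x⟩
  refine ciSup_le fun z => ?_
  have h := le_ciSup (bddAbove_supConv hC n y) z
  have ht := mul_le_mul_of_nonneg_left (dist_triangle_left y z x) (n.cast_nonneg (α := ℝ))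
  simp only [NNReal.coe_natCast]
  unfold supConv
  linarith

lemma tendsto_supConv (hf : UpperSemicontinuous f) (hC : ∀ x, |f x| ≤ C) (x : X) :
    Tendsto (fun n => supConv f n x) atTop (𝓝 (f x)) := by
  have : Nonempty X := ⟨x⟩
  refine tendsto_order.2 ⟨fun a ha => Eventually.of_forall fun n => ha.trans_le (le_supConv hC n x),
    fun a ha => ?_⟩
  obtain ⟨b, hb, hba⟩ := exists_between ha
  obtain ⟨δ, hδ, hball⟩ := Metric.eventually_nhds_iff.1 (hf x b hb)
  -- From this index on, the penalty at distance at least `δ` exceeds the oscillation `2 * C`, so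
  -- only points near `x` matter, where semicontinuity applies.
  obtain ⟨N, hN⟩ := exists_nat_ge (2 * C / δ)
  filter_upwards [eventually_ge_atTop N] with n hn
  refine (ciSup_le fun y => ?_).trans_lt hba
  by_cases hy : dist y x < δ
  · have := hball hy
    have : 0 ≤ (n : ℝ) * dist x y := by positivity
    linarith
  · push Not at hy
    rw [dist_comm] at hy
    have h1 : 2 * C ≤ n * δ := (div_le_iff₀ hδ).1 (hN.trans (Nat.cast_le.2 hn))
    have h2 := mul_le_mul_of_nonneg_left hy (n.cast_nonneg (α := ℝ))
    have := (abs_le.1 (hC y)).2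
    have := (abs_le.1 (hC x)).1
    linarith

end SupConv

/-- The sup-convolutions are continuous majorants of `f` converging to it. Dominated convergence is
available for the measure only; for `L` there is just monotonicity, hence an inequality. -/
theorem IsDominated.le_integral [∀ j, IsFiniteMeasure (ν j)] (hL : IsDominated ν L)
    {f : (Fin d → ℝ) → ℝ} (hf : UpperSemicontinuous f) (hb : ∃ C, ∀ x, |f x| ≤ C) :
    L f ≤ ∫ x, f x ∂hL.measure := by
  obtain ⟨C, hC⟩ := hb
  refine ge_of_tendsto' (tendsto_integral_of_dominated_convergence (fun _ => C)
    (fun n => (continuous_supConv hC n).aestronglyMeasurable) (integrable_const C)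
    (fun n => ae_of_all _ (abs_supConv_le hC n)) (ae_of_all _ (tendsto_supConv hf hC))) fun n => ?_
  rw [hL.integral_of_continuous (continuous_supConv hC n) ⟨C, abs_supConv_le hC n⟩]
  exact hL.mono ⟨C, hC⟩ ⟨C, abs_supConv_le hC n⟩ (le_supConv hC n)

lemma isClosed_orthant (c : Fin d → ℝ) : IsClosed (orthant c) :=
  isClosed_set_pi fun _ _ => isClosed_Iic

lemma exists_bound_indicator {X : Type*} (A : Set X) :
    ∃ C, ∀ x, |A.indicator (fun _ => (1 : ℝ)) x| ≤ C :=
  ⟨1, fun x => by by_cases h : x ∈ A <;> simp [h]⟩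

/-- Closedness gives one inequality. For the other, a point outside the orthant but within `δ` of it
has some coordinate in `(c j, c j + δ)`, and such strips have vanishing `ν j`-mass; hence `L` loses
nothing at the boundary. -/
theorem IsDominated.measureReal_orthant [∀ j, IsFiniteMeasure (ν j)] (hL : IsDominated ν L)
    (c : Fin d → ℝ) :
    hL.measure.real (orthant c) = L ((orthant c).indicator fun _ => 1) := by
  have hcl := isClosed_orthant c
  have hi : ∫ x, (orthant c).indicator (fun _ => (1 : ℝ)) x ∂hL.measure =
      hL.measure.real (orthant c) := integral_indicator_one hcl.measurableSet
  refine le_antisymm ?_ ?_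
  · have hlim : Tendsto (fun n : ℕ => L ((orthant c).indicator fun _ => 1) +
        ∑ j, (ν j).real (Set.Ioo (c j) (c j + 1 / ((n : ℝ) + 1)))) atTop
        (𝓝 (L ((orthant c).indicator fun _ => 1))) := by
      simpa using tendsto_const_nhds.add
        (tendsto_finsetSum Finset.univ fun j _ => tendsto_measureReal_Ioo (ν j) (c j))
    refine ge_of_tendsto' hlim fun n => ?_
    have hδ : (0 : ℝ) < 1 / ((n : ℝ) + 1) := Nat.one_div_pos_of_nat
    set δ : ℝ := 1 / ((n : ℝ) + 1)
    set g : (Fin d → ℝ) → ℝ := fun x => (thickenedIndicator hδ (orthant c) x : NNReal)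
    have hgc : Continuous g :=
      NNReal.continuous_coe.comp (thickenedIndicator hδ (orthant c)).continuous
    have hg1 : ∀ x, g x ≤ 1 := fun x => by
      exact_mod_cast thickenedIndicator_le_one hδ (orthant c) x
    have hg0 : ∀ x, 0 ≤ g x := fun x => NNReal.coe_nonneg _
    have hgb : ∃ C, ∀ x, |g x| ≤ C := ⟨1, fun x => by rw [abs_of_nonneg (hg0 x)]; exact hg1 x⟩
    set B : Fin d → Set ℝ := fun j => Set.Ioo (c j) (c j + δ)
    set s : (Fin d → ℝ) → ℝ := fun x => ∑ j, (B j).indicator (fun _ => (1 : ℝ)) (x j)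
    have hs0 : ∀ x : Fin d → ℝ, ∀ j ∈ Finset.univ, 0 ≤ (B j).indicator (fun _ => (1 : ℝ)) (x j) :=
      fun x j _ => Set.indicator_nonneg (fun _ _ => zero_le_one) _
    have hle : ∀ x, g x ≤ ((orthant c).indicator (fun _ => (1 : ℝ)) + s) x := by
      intro x
      rw [Pi.add_apply]
      by_cases hx : x ∈ orthant c
      · rw [Set.indicator_of_mem hx]
        linarith [hg1 x, Finset.sum_nonneg (hs0 x)]
      rw [Set.indicator_of_notMem hx, zero_add]
      by_cases hxt : x ∈ Metric.thickening δ (orthant c)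
      · obtain ⟨y, hy, hxy⟩ := Metric.mem_thickening_iff.1 hxt
        simp only [orthant, Set.mem_pi, Set.mem_univ, Set.mem_Iic, true_imp_iff] at hx hy
        push Not at hx
        obtain ⟨j, hj⟩ := hx
        have h1 := (le_abs_self _).trans_lt ((dist_le_pi_dist x y j).trans_lt hxy)
        have h2 := hy j
        have hmem : x j ∈ B j := ⟨hj, by linarith⟩
        refine le_trans ?_ (Finset.single_le_sum (hs0 x) (Finset.mem_univ j))
        rw [Set.indicator_of_mem hmem]
        exact hg1 x
      · have : g x = 0 := by
          simp only [g, thickenedIndicator_zero hδ _ hxt, NNReal.coe_zero]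
        rw [this]
        exact Finset.sum_nonneg (hs0 x)
    have hmono := hL.mono hgb (by
      obtain ⟨C₁, h₁⟩ := exists_bound_indicator (orthant c)
      obtain ⟨C₂, h₂⟩ := exists_bound_sum_indicator B
      exact ⟨C₁ + C₂, fun x => (abs_add_le _ _).trans (add_le_add (h₁ x) (h₂ x))⟩) hle
    rw [map_add] at hmono
    have hsum := hL.sum_indicator_le (B := B) fun j => measurableSet_Ioo
    have hint : hL.measure.real (orthant c) ≤ ∫ x, g x ∂hL.measure := by
      rw [← hi]
      refine integral_mono (integrable_of_bound
        (measurable_const.indicator hcl.measurableSet) (exists_bound_indicator _))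
        (integrable_of_bound hgc.measurable hgb) fun x => ?_
      by_cases hx : x ∈ orthant c
      · have : g x = 1 := by simp only [g, thickenedIndicator_one hδ _ hx, NNReal.coe_one]
        rw [Set.indicator_of_mem hx, this]
      · simpa [hx] using hg0 x
    rw [hL.integral_of_continuous hgc hgb] at hint
    linarith
  · rw [← hi]
    exact hL.le_integral (hcl.upperSemicontinuous_indicator zero_le_one)
      (exists_bound_indicator _)

end PositiveFunctional

end MarginalTransport

/-! ### Hahn-Banach extension -/

/-- A sublinear functional dominates a linear functional that agrees with it at a given point. -/
theorem exists_linearMap_le_sublinear_eq {E : Type*} [AddCommGroup E] [Module ℝ E] (N : E → ℝ)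
    (N_hom : ∀ r : ℝ, 0 < r → ∀ x, N (r • x) = r * N x)
    (N_add : ∀ x y, N (x + y) ≤ N x + N y) (x : E) :
    ∃ g : E →ₗ[ℝ] ℝ, g x = N x ∧ ∀ y, g y ≤ N y := by
  have N_zero : N 0 = 0 := by
    have := N_hom 2 two_pos 0
    rw [smul_zero] at this
    linarith
  have H : ∀ r : ℝ, r • x = 0 → r • N x = 0 := by
    intro r hr
    rcases smul_eq_zero.1 hr with rfl | rfl
    · exact zero_smul _ _
    · rw [N_zero, smul_zero]
  let p : E →ₗ.[ℝ] ℝ := LinearPMap.mkSpanSingleton' (σ := RingHom.id ℝ) x (N x) H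
  obtain ⟨g, hg, hgN⟩ := exists_extension_of_le_sublinear
    p N N_hom N_add (by
      rintro ⟨y, hy⟩
      obtain ⟨r, rfl⟩ := Submodule.mem_span_singleton.1 hy
      refine (LinearPMap.mkSpanSingleton'_apply (σ := RingHom.id ℝ) x (N x) H r hy).trans_le ?_
      rcases lt_trichotomy r 0 with hr | rfl | hr
      -- For negative `r`, subadditivity gives `0 ≤ N (r • x) + N ((-r) • x)`, and the last term is
      -- `-r * N x`.
      · have h1 := N_add (r • x) ((-r) • x)
        rw [← add_smul, add_neg_cancel, zero_smul, N_zero, N_hom (-r) (neg_pos.2 hr)] at h1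
        change r * N x ≤ N (r • x)
        linarith
      · change 0 * N x ≤ N ((0 : ℝ) • x)
        rw [zero_smul, N_zero, zero_mul]
      · exact (N_hom r hr x).ge)
  refine ⟨g, ?_, hgN⟩
  have hx : x ∈ p.domain := Submodule.mem_span_singleton_self x
  exact (hg ⟨x, hx⟩).trans (LinearPMap.mkSpanSingleton'_apply_self x (N x) H hx)

namespace MarginalTransport

/-! ### Strategies, their payoffs and prices -/

section Duality

variable {d : ℕ} {I : Type*} {ν : Fin d → Measure ℝ} {c : I → Fin d → ℝ} {πl πu : I → ℝ}

/-- The price of holding `r` units of an option with bid price `l` and ask price `u`. -/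
def optionPrice (l u r : ℝ) : ℝ := max r 0 * u - max (-r) 0 * l

lemma optionPrice_zero (l u : ℝ) : optionPrice l u 0 = 0 := by simp [optionPrice]

lemma optionPrice_of_nonneg {r : ℝ} (hr : 0 ≤ r) (l u : ℝ) : optionPrice l u r = r * u := by
  rw [optionPrice, max_eq_left hr, max_eq_right (neg_nonpos.2 hr), zero_mul, sub_zero]

lemma optionPrice_of_nonpos {r : ℝ} (hr : r ≤ 0) (l u : ℝ) : optionPrice l u r = r * l := by
  rw [optionPrice, max_eq_right hr, max_eq_left (neg_nonneg.2 hr)]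
  ring

/-- A nonnegative bid-ask spread makes the price a maximum of two linear functions, hence
subadditive. -/
lemma optionPrice_eq_max {l u : ℝ} (h : l ≤ u) (r : ℝ) :
    optionPrice l u r = max (r * u) (r * l) := by
  rcases le_total 0 r with hr | hr
  · rw [optionPrice_of_nonneg hr, max_eq_left (mul_le_mul_of_nonneg_left h hr)]
  · rw [optionPrice_of_nonpos hr, max_eq_right (mul_le_mul_of_nonpos_left h hr)]

lemma optionPrice_add_le {l u : ℝ} (h : l ≤ u) (r s : ℝ) :
    optionPrice l u (r + s) ≤ optionPrice l u r + optionPrice l u s := by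
  rw [optionPrice_eq_max h, optionPrice_eq_max h, optionPrice_eq_max h, add_mul, add_mul]
  exact max_le (add_le_add (le_max_left _ _) (le_max_left _ _))
    (add_le_add (le_max_right _ _) (le_max_right _ _))

lemma optionPrice_mul {r : ℝ} (hr : 0 ≤ r) (l u s : ℝ) :
    optionPrice l u (r * s) = r * optionPrice l u s := by
  rcases le_total 0 s with hs | hs
  · rw [optionPrice_of_nonneg hs, optionPrice_of_nonneg (mul_nonneg hr hs), mul_assoc]
  · rw [optionPrice_of_nonpos hs, optionPrice_of_nonpos (mul_nonpos_of_nonneg_of_nonpos hr hs),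
      mul_assoc]

lemma mul_le_optionPrice {l u m : ℝ} (hl : l ≤ m) (hu : m ≤ u) (r : ℝ) :
    r * m ≤ optionPrice l u r := by
  rcases le_total 0 r with hr | hr
  · rw [optionPrice_of_nonneg hr]; exact mul_le_mul_of_nonneg_left hu hr
  · rw [optionPrice_of_nonpos hr]; exact mul_le_mul_of_nonpos_left hl hr

namespace Strategy

lemma price_eq (h : Strategy d I) : h.price ν πl πu =
    (∑ j, ∫ t, h.f j t ∂(ν j)) + h.a.sum fun i r => optionPrice (πl i) (πu i) r := rfl

/-- The sum of two strategies. -/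
noncomputable def add (h k : Strategy d I) : Strategy d I where
  f j t := h.f j t + k.f j t
  measurable_f j := (h.measurable_f j).add (k.measurable_f j)
  bounded_f j := by
    obtain ⟨C, hC⟩ := h.bounded_f j
    obtain ⟨D, hD⟩ := k.bounded_f j
    exact ⟨C + D, fun t => (abs_add_le _ _).trans (add_le_add (hC t) (hD t))⟩
  a := h.a + k.a

/-- A multiple of a strategy. -/
noncomputable def smul (r : ℝ) (h : Strategy d I) : Strategy d I where
  f j t := r * h.f j t
  measurable_f j := (h.measurable_f j).const_mul r
  bounded_f j := by
    obtain ⟨C, hC⟩ := h.bounded_f j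
    refine ⟨|r| * C, fun t => ?_⟩
    rw [abs_mul]
    exact mul_le_mul_of_nonneg_left (hC t) (abs_nonneg r)
  a := r • h.a

/-- The strategy that pays a function of the `j`-th coordinate. -/
noncomputable def marginal (I : Type*) (j : Fin d) (g : ℝ → ℝ) (hg : Measurable g)
    (hb : ∃ C, ∀ t, |g t| ≤ C) : Strategy d I where
  f k t := if k = j then g t else 0
  measurable_f k := by
    by_cases h : k = j
    · simpa [h] using hg
    · simp [h]
  bounded_f k := by
    by_cases h : k = j
    · simpa [h] using hb
    · exact ⟨0, by simp [h]⟩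
  a := 0

/-- The strategy that pays the constant `r`. -/
noncomputable def const (I : Type*) (j : Fin d) (r : ℝ) : Strategy d I :=
  marginal I j (fun _ => r) measurable_const ⟨|r|, fun _ => le_rfl⟩

/-- The strategy that holds `r` units of the option with index `i`. -/
noncomputable def option (d : ℕ) (i : I) (r : ℝ) : Strategy d I where
  f _ _ := 0
  measurable_f _ := measurable_const
  bounded_f _ := ⟨0, by simp⟩
  a := Finsupp.single i r

lemma payoff_add (h k : Strategy d I) (x : Fin d → ℝ) :
    (h.add k).payoff c x = h.payoff c x + k.payoff c x := by
  simp only [payoff, add, Finset.sum_add_distrib]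
  rw [Finsupp.sum_add_index' (fun _ => zero_mul _) fun _ _ _ => add_mul _ _ _]
  ring

lemma payoff_smul (r : ℝ) (h : Strategy d I) (x : Fin d → ℝ) :
    (h.smul r).payoff c x = r * h.payoff c x := by
  simp only [payoff, smul, mul_add, Finset.mul_sum]
  rw [Finsupp.sum_smul_index fun _ => zero_mul _, Finsupp.mul_sum]
  simp only [mul_assoc]

lemma payoff_marginal {j : Fin d} {g : ℝ → ℝ} (hg : Measurable g) (hb : ∃ C, ∀ t, |g t| ≤ C)
    (x : Fin d → ℝ) : (marginal I j g hg hb).payoff c x = g (x j) := by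
  simp [payoff, marginal]

lemma payoff_const (j : Fin d) (r : ℝ) (x : Fin d → ℝ) : (const I j r).payoff c x = r :=
  payoff_marginal _ _ x

lemma payoff_option (i : I) (r : ℝ) (x : Fin d → ℝ) :
    (option d i r).payoff c x = r * (orthant (c i)).indicator (fun _ => (1 : ℝ)) x := by
  simp [payoff, option]

lemma price_add_le [∀ j, IsFiniteMeasure (ν j)] (hπ : ∀ i, πl i ≤ πu i) (h k : Strategy d I) :
    (h.add k).price ν πl πu ≤ h.price ν πl πu + k.price ν πl πu := by
  classical
  have hint : ∀ j, ∫ t, (h.add k).f j t ∂(ν j) = ∫ t, h.f j t ∂(ν j) + ∫ t, k.f j t ∂(ν j) :=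
    fun j => integral_add (integrable_of_bound (h.measurable_f j) (h.bounded_f j))
      (integrable_of_bound (k.measurable_f j) (k.bounded_f j))
  -- All three sums are taken over one common finite set, since positions may cancel in the sum of
  -- the strategies.
  have hsum : ∀ a : I →₀ ℝ, a.support ⊆ h.a.support ∪ k.a.support →
      (a.sum fun i r => optionPrice (πl i) (πu i) r) =
        ∑ i ∈ h.a.support ∪ k.a.support, optionPrice (πl i) (πu i) (a i) :=
    fun a ha => Finsupp.sum_of_support_subset _ ha _ fun i _ => optionPrice_zero _ _
  have hle : ((h.add k).a.sum fun i r => optionPrice (πl i) (πu i) r) ≤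
      (h.a.sum fun i r => optionPrice (πl i) (πu i) r) +
        k.a.sum fun i r => optionPrice (πl i) (πu i) r := by
    rw [hsum (h.add k).a Finsupp.support_add, hsum _ Finset.subset_union_left,
      hsum _ Finset.subset_union_right, ← Finset.sum_add_distrib]
    exact Finset.sum_le_sum fun i _ => optionPrice_add_le (hπ i) _ _
  simp only [price_eq, hint, Finset.sum_add_distrib]
  linarith

lemma price_smul {r : ℝ} (hr : 0 ≤ r) (h : Strategy d I) :
    (h.smul r).price ν πl πu = r * h.price ν πl πu := by
  simp only [price_eq, smul, integral_const_mul, mul_add, Finset.mul_sum]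
  rw [Finsupp.sum_smul_index fun _ => optionPrice_zero _ _, Finsupp.mul_sum]
  simp only [optionPrice_mul hr]

lemma price_marginal {j : Fin d} {g : ℝ → ℝ} (hg : Measurable g) (hb : ∃ C, ∀ t, |g t| ≤ C) :
    (marginal I j g hg hb).price ν πl πu = ∫ t, g t ∂(ν j) := by
  rw [price, Finset.sum_eq_single j (fun k _ hk => by simp [marginal, hk]) (by simp)]
  simp [marginal]

lemma price_const [∀ j, IsProbabilityMeasure (ν j)] (j : Fin d) (r : ℝ) :
    (const I j r).price ν πl πu = r := by
  rw [const, price_marginal]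
  simp

lemma price_option (i : I) (r : ℝ) :
    (option d i r).price ν πl πu = optionPrice (πl i) (πu i) r := by
  rw [price_eq]
  simp [option, optionPrice_zero]

lemma measurable_payoff (h : Strategy d I) : Measurable (h.payoff c) := by
  refine Measurable.add (Finset.measurable_sum _ fun j _ =>
    (h.measurable_f j).comp (measurable_pi_apply j)) (Finset.measurable_sum _ fun i _ => ?_)
  exact (measurable_const.indicator (isClosed_orthant (c i)).measurableSet).const_mul _

lemma bounded_payoff (h : Strategy d I) : ∃ C, ∀ x, |h.payoff c x| ≤ C := by
  choose C hC using h.bounded_f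
  refine ⟨∑ j, C j + ∑ i ∈ h.a.support, |h.a i|, fun x => (abs_add_le _ _).trans (add_le_add ?_ ?_)⟩
  · exact (Finset.abs_sum_le_sum_abs _ _).trans (Finset.sum_le_sum fun j _ => hC j _)
  · refine (Finset.abs_sum_le_sum_abs _ _).trans (Finset.sum_le_sum fun i _ => ?_)
    rw [abs_mul]
    refine mul_le_of_le_one_right (abs_nonneg _) ?_
    by_cases hx : x ∈ orthant (c i) <;> simp [hx]

lemma integral_payoff {μ : Measure (Fin d → ℝ)} [IsFiniteMeasure μ] (h : Strategy d I) :
    ∫ x, h.payoff c x ∂μ = (∑ j, ∫ t, h.f j t ∂(μ.map fun x => x j)) +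
      h.a.sum fun i r => r * μ.real (orthant (c i)) := by
  have hmeas : ∀ i, MeasurableSet (orthant (c i)) := fun i => (isClosed_orthant (c i)).measurableSet
  have h1 : ∀ j, Integrable (fun x : Fin d → ℝ => h.f j (x j)) μ := fun j =>
    integrable_of_bound ((h.measurable_f j).comp (measurable_pi_apply j)) (by
      obtain ⟨C, hC⟩ := h.bounded_f j
      exact ⟨C, fun x => hC _⟩)
  have h2 : ∀ i, Integrable (fun x => h.a i * (orthant (c i)).indicator (fun _ => (1 : ℝ)) x) μ :=
    fun i => (integrable_of_bound (measurable_const.indicator (hmeas i))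
      (exists_bound_indicator _)).const_mul _
  simp only [payoff, Finsupp.sum]
  rw [integral_add (integrable_finsetSum _ fun j _ => h1 j)
    (integrable_finsetSum _ fun i _ => h2 i), integral_finsetSum _ fun j _ => h1 j,
    integral_finsetSum _ fun i _ => h2 i]
  congr 1
  · refine Finset.sum_congr rfl fun j _ => ?_
    rw [integral_map (measurable_pi_apply j).aemeasurable (h.measurable_f j).aestronglyMeasurable]
  · refine Finset.sum_congr rfl fun i _ => ?_
    rw [integral_const_mul]
    congr 1
    exact integral_indicator_one (hmeas i)

/-- Weak duality. -/
lemma integral_le_price {μ : Measure (Fin d → ℝ)} [IsFiniteMeasure μ] (h : Strategy d I)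
    (hmarg : ∀ j, ∫ t, h.f j t ∂(μ.map fun x => x j) ≤ ∫ t, h.f j t ∂(ν j))
    (hopt : ∀ i, h.a i * μ.real (orthant (c i)) ≤ optionPrice (πl i) (πu i) (h.a i))
    {f : (Fin d → ℝ) → ℝ} (hf : Measurable f) (hb : ∃ C, ∀ x, |f x| ≤ C)
    (hh : h ∈ superhedges c f) : ∫ x, f x ∂μ ≤ h.price ν πl πu := by
  calc ∫ x, f x ∂μ ≤ ∫ x, h.payoff c x ∂μ :=
        integral_mono (integrable_of_bound hf hb)
          (integrable_of_bound h.measurable_payoff h.bounded_payoff) hh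
    _ ≤ h.price ν πl πu := by
        rw [integral_payoff, price_eq]
        exact add_le_add (Finset.sum_le_sum fun j _ => hmarg j)
          (Finset.sum_le_sum fun i _ => hopt i)

end Strategy

/-! ### Pricing cones and strong duality -/

/-- A convex cone of strategies that contains the nonnegative ones and in which a payoff bounded
below by a constant `-C ≤ 0` costs at least `-C`. -/
structure IsPricingCone (ν : Fin d → Measure ℝ) (c : I → Fin d → ℝ) (πl πu : I → ℝ)
    (S : Set (Strategy d I)) : Prop where
  add_mem : ∀ h ∈ S, ∀ k ∈ S, h.add k ∈ S
  smul_mem : ∀ r : ℝ, 0 < r → ∀ h ∈ S, h.smul r ∈ S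
  nonneg_mem : ∀ h : Strategy d I, (∀ j t, 0 ≤ h.f j t) → (∀ i, 0 ≤ h.a i) → h ∈ S
  le_price : ∀ h ∈ S, ∀ C : ℝ, 0 ≤ C → (∀ x, -C ≤ h.payoff c x) → -C ≤ h.price ν πl πu

/-- The prices of the strategies in `S` that superhedge `g`. -/
def hedgingPrices (ν : Fin d → Measure ℝ) (c : I → Fin d → ℝ) (πl πu : I → ℝ)
    (S : Set (Strategy d I)) (g : (Fin d → ℝ) → ℝ) : Set ℝ :=
  (fun h => h.price ν πl πu) '' (S ∩ superhedges c g)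

/-- The space of bounded functions. -/
def boundedFunctions (X : Type*) : Submodule ℝ (X → ℝ) where
  carrier := {g | ∃ C, ∀ x, |g x| ≤ C}
  zero_mem' := ⟨0, by simp⟩
  add_mem' := by
    rintro g₁ g₂ ⟨C₁, h₁⟩ ⟨C₂, h₂⟩
    exact ⟨C₁ + C₂, fun x => (abs_add_le _ _).trans (add_le_add (h₁ x) (h₂ x))⟩
  smul_mem' := by
    rintro r g ⟨C, hC⟩
    refine ⟨|r| * C, fun x => ?_⟩
    rw [Pi.smul_apply, smul_eq_mul, abs_mul]
    exact mul_le_mul_of_nonneg_left (hC x) (abs_nonneg r)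

namespace IsPricingCone

variable {S : Set (Strategy d I)} {g : (Fin d → ℝ) → ℝ}

lemma const_mem (hS : IsPricingCone ν c πl πu S) (j : Fin d) {r : ℝ} (hr : 0 ≤ r) :
    Strategy.const I j r ∈ S := by
  refine hS.nonneg_mem _ (fun k t => ?_) fun i => le_rfl
  change 0 ≤ if k = j then r else 0
  split_ifs <;> simp [hr]

lemma nonempty_hedgingPrices (hd : 1 ≤ d) (hS : IsPricingCone ν c πl πu S)
    (hg : ∃ C, ∀ x, |g x| ≤ C) : (hedgingPrices ν c πl πu S g).Nonempty := by
  obtain ⟨C, hC⟩ := hg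
  refine ⟨_, _, ⟨hS.const_mem ⟨0, hd⟩ ((abs_nonneg _).trans (hC 0)), fun x => ?_⟩, rfl⟩
  rw [Strategy.payoff_const]
  exact (abs_le.1 (hC x)).2

lemma bddBelow_hedgingPrices (hS : IsPricingCone ν c πl πu S)
    (hg : ∃ C, ∀ x, |g x| ≤ C) : BddBelow (hedgingPrices ν c πl πu S g) := by
  obtain ⟨C, hC⟩ := hg
  refine ⟨-C, ?_⟩
  rintro _ ⟨h, ⟨hh, hhg⟩, rfl⟩
  exact hS.le_price h hh C ((abs_nonneg _).trans (hC 0)) fun x => (abs_le.1 (hC x)).1.trans (hhg x)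

/-- One inequality suffices for homogeneity: the reverse is the case `r⁻¹` applied to `r • g`. -/
lemma sInf_hedgingPrices_smul_le (hd : 1 ≤ d) (hS : IsPricingCone ν c πl πu S)
    (hg : ∃ C, ∀ x, |g x| ≤ C) {r : ℝ} (hr : 0 < r) :
    sInf (hedgingPrices ν c πl πu S (r • g)) ≤ r * sInf (hedgingPrices ν c πl πu S g) := by
  rw [← div_le_iff₀' hr]
  refine le_csInf (hS.nonempty_hedgingPrices hd hg) ?_
  rintro _ ⟨h, ⟨hh, hhg⟩, rfl⟩
  rw [div_le_iff₀' hr, ← h.price_smul hr.le]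
  refine csInf_le (hS.bddBelow_hedgingPrices ((boundedFunctions _).smul_mem r hg))
    ⟨_, ⟨hS.smul_mem r hr h hh, fun x => ?_⟩, rfl⟩
  rw [Strategy.payoff_smul]
  exact mul_le_mul_of_nonneg_left (hhg x) hr.le

/-- The Hahn-Banach step: a linear functional that is dominated by prices and agrees with the
superhedging value at `f`. -/
theorem exists_linearMap (hd : 1 ≤ d) [∀ j, IsFiniteMeasure (ν j)] (hπ : ∀ i, πl i ≤ πu i)
    (hS : IsPricingCone ν c πl πu S) {f : (Fin d → ℝ) → ℝ} (hf : ∃ C, ∀ x, |f x| ≤ C) :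
    ∃ L : ((Fin d → ℝ) → ℝ) →ₗ[ℝ] ℝ, L f = sInf (hedgingPrices ν c πl πu S f) ∧
      ∀ g, (∃ C, ∀ x, |g x| ≤ C) → ∀ h ∈ S, h ∈ superhedges c g → L g ≤ h.price ν πl πu := by
  obtain ⟨L, hLf, hL⟩ := exists_linearMap_le_sublinear_eq
    (fun g : boundedFunctions (Fin d → ℝ) => sInf (hedgingPrices ν c πl πu S g))
    (fun r hr g => by
      refine le_antisymm (hS.sInf_hedgingPrices_smul_le hd g.2 hr) ?_
      have := hS.sInf_hedgingPrices_smul_le hd (r • g).2 (inv_pos.2 hr)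
      rw [Submodule.coe_smul, inv_smul_smul₀ hr.ne', le_inv_mul_iff₀ hr] at this
      exact this)
    (fun g₁ g₂ => by
      rw [← csInf_add (hS.nonempty_hedgingPrices hd g₁.2) (hS.bddBelow_hedgingPrices g₁.2)
        (hS.nonempty_hedgingPrices hd g₂.2) (hS.bddBelow_hedgingPrices g₂.2)]
      refine le_csInf ((hS.nonempty_hedgingPrices hd g₁.2).add
        (hS.nonempty_hedgingPrices hd g₂.2)) ?_
      rintro _ ⟨_, ⟨h, ⟨hh, hhg⟩, rfl⟩, _, ⟨k, ⟨hk, hkg⟩, rfl⟩, rfl⟩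
      refine (csInf_le (hS.bddBelow_hedgingPrices (g₁ + g₂).2)
        ⟨_, ⟨hS.add_mem h hh k hk, fun x => ?_⟩, rfl⟩).trans (h.price_add_le hπ k)
      rw [Strategy.payoff_add]
      exact add_le_add (hhg x) (hkg x))
    ⟨f, hf⟩
  -- The extension to unbounded functions is arbitrary and only spares later arguments the subtype.
  obtain ⟨L', hL'⟩ := LinearMap.exists_extend L
  have heq : ∀ g : boundedFunctions (Fin d → ℝ), L' g = L g := fun g => LinearMap.congr_fun hL' g
  refine ⟨L', (heq ⟨f, hf⟩).trans hLf, fun g hg h hh hhg => ?_⟩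
  rw [heq ⟨g, hg⟩]
  exact (hL _).trans (csInf_le (hS.bddBelow_hedgingPrices hg) ⟨h, ⟨hh, hhg⟩, rfl⟩)

/-- Strong duality with attainment for a pricing cone. -/
theorem exists_measure (hd : 1 ≤ d) [∀ j, IsProbabilityMeasure (ν j)] (hπ : ∀ i, πl i ≤ πu i)
    (hS : IsPricingCone ν c πl πu S) {f : (Fin d → ℝ) → ℝ} (hf : UpperSemicontinuous f)
    (hfb : ∃ C, ∀ x, |f x| ≤ C) :
    ∃ μ : Measure (Fin d → ℝ), IsFiniteMeasure μ ∧ (∀ j, μ.map (fun x => x j) ≤ ν j) ∧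
      (∀ r, Strategy.const I ⟨0, hd⟩ r ∈ S → r * μ.real Set.univ ≤ r) ∧
      (∀ i r, Strategy.option d i r ∈ S →
        r * μ.real (orthant (c i)) ≤ optionPrice (πl i) (πu i) r) ∧
      ⨅ h ∈ S ∩ superhedges c f, ((h.price ν πl πu : ℝ) : EReal) ≤ ((∫ x, f x ∂μ : ℝ) : EReal) := by
  obtain ⟨L, hLf, hL⟩ := hS.exists_linearMap hd hπ hfb
  have hdom : IsDominated ν L := by
    refine ⟨fun g ⟨C, hC⟩ hg => ?_, fun j g hg hb h0 => ?_⟩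
    -- Positivity: the zero strategy superhedges `-g` at price zero.
    · have := hL (-g) ⟨C, fun x => by rw [Pi.neg_apply, abs_neg]; exact hC x⟩ _
        (hS.const_mem ⟨0, hd⟩ le_rfl) fun x => by
          rw [Strategy.payoff_const]; exact neg_nonpos.2 (hg x)
      rw [map_neg, Strategy.price_const] at this
      linarith
    · have := hL (fun x => g (x j)) (hb.imp fun C hC x => hC _) (Strategy.marginal I j g hg hb)
        (hS.nonneg_mem _ (fun k t => ?_) fun i => le_rfl)
        fun x => (Strategy.payoff_marginal hg hb x).ge
      · rwa [Strategy.price_marginal] at this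
      · change 0 ≤ if k = j then g t else 0
        split_ifs <;> simp [h0]
  refine ⟨hdom.measure, hdom.isFiniteMeasure, hdom.map_measure_le, fun r hr => ?_, fun i r hr => ?_,
    EReal.le_of_forall_lt_iff_le.1 fun z hz => ?_⟩
  · have h1 := hL (r • fun _ => 1) ((boundedFunctions _).smul_mem r ⟨1, by simp⟩) _ hr
      fun x => by rw [Strategy.payoff_const]; simp
    rw [map_smul, Strategy.price_const, ← hdom.integral_of_continuous continuous_const
      ⟨1, by simp⟩] at h1
    simpa using h1
  · have h1 := hL (r • (orthant (c i)).indicator fun _ => 1)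
      ((boundedFunctions _).smul_mem r (exists_bound_indicator _)) _ hr
      fun x => (Strategy.payoff_option i r x).ge
    rwa [map_smul, smul_eq_mul, Strategy.price_option, ← hdom.measureReal_orthant] at h1
  · have h1 := (hLf.ge.trans (hdom.le_integral hf hfb)).trans_lt (EReal.coe_lt_coe_iff.1 hz)
    obtain ⟨_, ⟨h, hh, rfl⟩, hlt⟩ := exists_lt_of_csInf_lt (hS.nonempty_hedgingPrices hd hfb) h1
    exact (iInf₂_le h hh).trans (EReal.coe_le_coe_iff.2 hlt.le)

end IsPricingCone

/-! ### The two cones and their dual measures -/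

lemma isPricingCone_univ (hd : 1 ≤ d) [∀ j, IsProbabilityMeasure (ν j)] (hπ : ∀ i, πl i ≤ πu i)
    (hna : ¬ ∃ h : Strategy d I, IsUniformStrongArbitrage ν c πl πu h) :
    IsPricingCone ν c πl πu (Set.univ : Set (Strategy d I)) where
  add_mem _ _ _ _ := trivial
  smul_mem _ _ _ _ := trivial
  nonneg_mem _ _ _ := trivial
  le_price h _ C _ hC := by
    by_contra! hlt
    -- If the price were below `-C`, adding cash equal to its negative would bring the cost to at
    -- most zero and leave a payoff of at least `-C - price > 0`.
    refine hna ⟨h.add (Strategy.const I ⟨0, hd⟩ (-h.price ν πl πu)), -C - h.price ν πl πu,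
      by linarith, fun x => ?_, (h.price_add_le hπ _).trans ?_⟩
    · rw [Strategy.payoff_add, Strategy.payoff_const]
      linarith [hC x]
    · rw [Strategy.price_const]
      linarith

lemma isPricingCone_nonneg (hπ : ∀ i, 0 ≤ πu i) :
    IsPricingCone ν c πl πu {h : Strategy d I | (∀ j t, 0 ≤ h.f j t) ∧ ∀ i, 0 ≤ h.a i} where
  add_mem h hh k hk := ⟨fun j t => add_nonneg (hh.1 j t) (hk.1 j t),
    fun i => add_nonneg (hh.2 i) (hk.2 i)⟩
  smul_mem r hr h hh := ⟨fun j t => mul_nonneg hr.le (hh.1 j t), fun i => mul_nonneg hr.le (hh.2 i)⟩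
  nonneg_mem _ h₁ h₂ := ⟨h₁, h₂⟩
  le_price h hh C hC _ := by
    refine (neg_nonpos.2 hC).trans (add_nonneg
      (Finset.sum_nonneg fun j _ => integral_nonneg (hh.1 j)) (Finset.sum_nonneg fun i _ => ?_))
    exact (mul_nonneg (hh.2 i) (hπ i)).trans_eq
      (optionPrice_of_nonneg (hh.2 i) (πl i) (πu i)).symm

lemma integral_le_price_of_mem_couplings {μ : Measure (Fin d → ℝ)}
    (hμ : μ ∈ couplings ν c πl πu) {f : (Fin d → ℝ) → ℝ} (hf : Measurable f)
    (hb : ∃ C, ∀ x, |f x| ≤ C) {h : Strategy d I} (hh : h ∈ superhedges c f) :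
    ∫ x, f x ∂μ ≤ h.price ν πl πu := by
  obtain ⟨hp, hm, ho⟩ := hμ
  exact h.integral_le_price (fun j => by rw [hm j])
    (fun i => mul_le_optionPrice (ho i).1 (ho i).2 _) hf hb hh

lemma integral_le_price_of_mem_subcouplings [∀ j, IsFiniteMeasure (ν j)]
    {μ : Measure (Fin d → ℝ)}
    (hμ : μ ∈ subcouplings ν c πu) {f : (Fin d → ℝ) → ℝ} (hf : Measurable f)
    (hb : ∃ C, ∀ x, |f x| ≤ C) {h : Strategy d I} (hh : h ∈ superhedgesNonneg c f) :
    ∫ x, f x ∂μ ≤ h.price ν πl πu := by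
  obtain ⟨hp, hm, ho⟩ := hμ
  obtain ⟨hh, hf0, ha0⟩ := hh
  have : IsFiniteMeasure μ := ⟨hp.trans_lt ENNReal.one_lt_top⟩
  refine h.integral_le_price (fun j => ?_) (fun i => ?_) hf hb hh
  · exact integral_mono_measure (Measure.le_iff.2 (hm j)) (ae_of_all _ (hf0 j))
      (integrable_of_bound (h.measurable_f j) (h.bounded_f j))
  · rw [optionPrice_of_nonneg (ha0 i)]
    exact mul_le_mul_of_nonneg_left (ho i) (ha0 i)

/-- Every position may be taken with either sign. Constants `1` and `-1` force mass one, which turns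
marginal domination into equality; long and short options give the ask and bid bounds. -/
lemma exists_mem_couplings (hd : 1 ≤ d) [∀ j, IsProbabilityMeasure (ν j)] (hπ : ∀ i, πl i ≤ πu i)
    (hna : ¬ ∃ h : Strategy d I, IsUniformStrongArbitrage ν c πl πu h)
    {f : (Fin d → ℝ) → ℝ} (hf : UpperSemicontinuous f) (hfb : ∃ C, ∀ x, |f x| ≤ C) :
    ∃ μ ∈ couplings ν c πl πu,
      superhedgingValue ν c πl πu f ≤ ((∫ x, f x ∂μ : ℝ) : EReal) := by
  obtain ⟨μ, hμ, hm, hc, ho, hv⟩ := (isPricingCone_univ hd hπ hna).exists_measure hd hπ hf hfb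
  have hle := hc 1 trivial
  have hge := hc (-1) trivial
  have huniv : μ.real Set.univ = 1 := by linarith
  have hp : IsProbabilityMeasure μ := ⟨by
    rw [← ENNReal.ofReal_toReal (measure_ne_top μ Set.univ)]
    exact (congrArg ENNReal.ofReal huniv).trans ENNReal.ofReal_one⟩
  refine ⟨μ, ⟨hp, fun j => ?_, fun i => ⟨?_, ?_⟩⟩, ?_⟩
  · have := Measure.isProbabilityMeasure_map (μ := μ) (measurable_pi_apply j).aemeasurable
    exact Measure.eq_of_le_of_isProbabilityMeasure (hm j)
  · have := ho i (-1) trivial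
    rw [optionPrice_of_nonpos (by norm_num)] at this
    linarith
  · have := ho i 1 trivial
    rw [optionPrice_of_nonneg zero_le_one] at this
    linarith
  · rwa [Set.univ_inter] at hv

/-- Only long positions are available, so only the upper bounds on mass and option prices survive.
-/
lemma exists_mem_subcouplings (hd : 1 ≤ d) [∀ j, IsProbabilityMeasure (ν j)]
    (hπ : ∀ i, πl i ≤ πu i) (hπ0 : ∀ i, 0 ≤ πu i)
    {f : (Fin d → ℝ) → ℝ} (hf : UpperSemicontinuous f) (hfb : ∃ C, ∀ x, |f x| ≤ C) :
    ∃ μ ∈ subcouplings ν c πu,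
      superhedgingValueNonneg ν c πl πu f ≤ ((∫ x, f x ∂μ : ℝ) : EReal) := by
  have hS : IsPricingCone ν c πl πu {h : Strategy d I | (∀ j t, 0 ≤ h.f j t) ∧ ∀ i, 0 ≤ h.a i} :=
    isPricingCone_nonneg hπ0
  obtain ⟨μ, hμ, hm, hc, ho, hv⟩ := hS.exists_measure hd hπ hf hfb
  have hle := hc 1 (hS.const_mem _ zero_le_one)
  refine ⟨μ, ⟨?_, fun j B _ => hm j B, fun i => ?_⟩, ?_⟩
  · rw [← ENNReal.ofReal_toReal (measure_ne_top μ Set.univ), ← ENNReal.ofReal_one]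
    exact ENNReal.ofReal_le_ofReal ((one_mul (μ.real Set.univ)).ge.trans hle)
  · have := ho i 1 ⟨fun _ _ => le_rfl, fun k => by
      classical
      change 0 ≤ Finsupp.single i (1 : ℝ) k
      rw [Finsupp.single_apply]
      split_ifs <;> simp⟩
    rw [optionPrice_of_nonneg zero_le_one] at this
    linarith
  · rwa [Set.inter_comm] at hv

end Duality

end MarginalTransport

/-! ### The duality theorem -/

open MarginalTransport in
theorem theorem2p3 {d : ℕ} (hd : 1 ≤ d) {I : Type*}
    (ν : Fin d → MeasureTheory.Measure ℝ) [∀ j, MeasureTheory.IsProbabilityMeasure (ν j)]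
    (c : I → Fin d → ℝ) (πl πu : I → ℝ)
    (hπ : ∀ i, 0 ≤ πl i ∧ πl i ≤ πu i ∧ πu i ≤ 1)
    (f : (Fin d → ℝ) → ℝ) (hf : UpperSemicontinuous f) (hfb : ∃ C : ℝ, ∀ x, |f x| ≤ C) :
    ((¬ ∃ h : MarginalTransport.Strategy d I,
        MarginalTransport.IsUniformStrongArbitrage ν c πl πu h) ↔
      (MarginalTransport.couplings ν c πl πu).Nonempty) ∧
    ((MarginalTransport.couplings ν c πl πu).Nonempty →
      IsGreatest ((fun μ : MeasureTheory.Measure (Fin d → ℝ) => ((∫ x, f x ∂μ : ℝ) : EReal)) ''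
          MarginalTransport.couplings ν c πl πu)
        (MarginalTransport.superhedgingValue ν c πl πu f)) ∧
    IsGreatest ((fun μ : MeasureTheory.Measure (Fin d → ℝ) => ((∫ x, f x ∂μ : ℝ) : EReal)) ''
        MarginalTransport.subcouplings ν c πu)
      (MarginalTransport.superhedgingValueNonneg ν c πl πu f) := by
  have hlu : ∀ i, πl i ≤ πu i := fun i => (hπ i).2.1
  have hna : (couplings ν c πl πu).Nonempty →
      ¬ ∃ h : Strategy d I, IsUniformStrongArbitrage ν c πl πu h := by
    rintro ⟨μ, hμ⟩ ⟨h, ε, hε, hh, hp⟩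
    -- Weak duality for the constant `ε` gives an arbitrage a price of at least `ε > 0`.
    have := integral_le_price_of_mem_couplings hμ measurable_const ⟨|ε|, fun _ => le_rfl⟩ hh
    have := hμ.1
    simp only [integral_const, probReal_univ, one_smul] at *
    linarith
  have hub : superhedgingValue ν c πl πu f ∈ upperBounds
      ((fun μ : Measure (Fin d → ℝ) => ((∫ x, f x ∂μ : ℝ) : EReal)) '' couplings ν c πl πu) := by
    rintro _ ⟨μ, hμ, rfl⟩
    exact le_iInf₂ fun h hh => EReal.coe_le_coe_iff.2
      (integral_le_price_of_mem_couplings hμ hf.measurable hfb hh)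
  have hub₀ : superhedgingValueNonneg ν c πl πu f ∈ upperBounds
      ((fun μ : Measure (Fin d → ℝ) => ((∫ x, f x ∂μ : ℝ) : EReal)) '' subcouplings ν c πu) := by
    rintro _ ⟨μ, hμ, rfl⟩
    exact le_iInf₂ fun h hh => EReal.coe_le_coe_iff.2
      (integral_le_price_of_mem_subcouplings hμ hf.measurable hfb hh)
  refine ⟨⟨fun h => ?_, hna⟩, fun hne => ⟨?_, hub⟩, ?_, hub₀⟩
  · obtain ⟨μ, hμ, -⟩ := exists_mem_couplings hd hlu h hf hfb
    exact ⟨μ, hμ⟩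
  · obtain ⟨μ, hμ, hle⟩ := exists_mem_couplings hd hlu (hna hne) hf hfb
    exact ⟨μ, hμ, le_antisymm (hub ⟨μ, hμ, rfl⟩) hle⟩
  · obtain ⟨μ, hμ, hle⟩ := exists_mem_subcouplings hd hlu
      (fun i => (hπ i).1.trans (hlu i)) hf hfb (πl := πl) (c := c) (ν := ν)
    exact ⟨μ, hμ, le_antisymm (hub₀ ⟨μ, hμ, rfl⟩) hle⟩
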